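/- Let $A_1,A_2,A_3>0$ be the principal moments of inertia of a heavy rigid body at its fixed point and $(x_1,x_2,x_3)\neq 0$ the coordinates of its centre of mass in the principal axes, subject to the Hess conditions $$x_3=0,\qquad A_2(A_3-A_1)x_2^2=A_1(A_2-A_3)x_1^2,\qquad A_2\ge A_3\ge A_1 .$$ Put $b=\frac{(A_1-A_2)x_1x_2}{A_1A_2(x_1^2+x_2^2)}$, $c=\frac1{A_3}$, $d_1=\frac bc$, and let $h,k_1\in\mathbb R$ (the dimensionless constants of the energy and area integrals). Let $P_6(x)=x^6-4hx^4+4(h^2-1)x^2+4k_1^2$. The motion reduces to the linear equation $$u''+a(x)u'+b(x)u=0,\qquad b(x)=\frac{(d_1x^3+k_1)(d_1x^3-k_1)}{x^2P_6(x)},$$ $$a(x)=\frac{d_1x^9-4k_1x^6-4d_1(h^2-1)x^5+12k_1hx^4-8k_1^2d_1x^3-8k_1(h^2-1)x^2-4k_1^3}{xP_6(x)(d_1x^3-k_1)},\tag{E}$$ and, through $y=u\exp\left(\frac12\int a\,dx\right)$, to its reduced form $$y''=R(x)\,y,\qquad R=\tfrac12a'+\tfrac14a^2-b\in\mathbb C(x).\tag{E'}$$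 A solution of (E') is of type 1 if it has the form $\exp\left(\int\omega\,dx\right)$ with $\omega\in\mathbb C(x)$. Equation (E') is said to have a liouvillian solution of type 2 if it has a solution $\exp\left(\int\omega\,dx\right)$ with $\omega$ algebraic of degree $2$ over $\mathbb C(x)$ and it has no solution of type 1. A function is liouvillian if it lies in a differential field obtained from $\mathbb C(x)$ by finitely many adjunctions of exponentials of integrals, integrals, and algebraic elements. Assume that $d_1=0$ (the Lagrange case), that $k_1\ne0$, and that the six complex roots of $P_6$ are distinct. Then all solutions of (E') are liouvillian of type 2: (E') has no solution of type 1, it has a solution of type 2, and every solution of (E'), in any differential field extension of $\mathbb C(x)$, is a liouvillian function that is a linear combination with constant coefficients of two linearly independent solutions of the form $\exp\left(\int\omega\,dx\right)$ with $\omega$ of degree $2$ over $\mathbb C(x)$. Explicitly, let $U\subseteq\mathbb C$ be open and connected, containing neither $0$ nor a root of $P_6$, and suppose that branches of $\sqrt{P_6}$, of $\int\frac{k_1\,dx}{x\sqrt{P_6}}$ and of $\frac12\int a\,dx$ are given on $U$ (on every disc that avoids $0$ and the roots of $P_6$ such branches exist). Then the holomorphic solutions of (E) on $U$ are exactly the functions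 $$u(x)=C_1\exp\left(\int\frac{k_1\,dx}{x\sqrt{P_6(x)}}\right)+C_2\exp\left(-\int\frac{k_1\,dx}{x\sqrt{P_6(x)}}\right),\qquad C_1,C_2\in\mathbb C,$$ and the holomorphic solutions of (E') on $U$ are exactly the functions $y=u\exp\left(\frac12\int a\,dx\right)$ with $u$ of this form. -/

import Mathlib

open scoped Differential

universe u

noncomputable section

namespace HessTop

/-! ### The differential field `ℂ(x)` -/

/-- The quotient rule on numerator and denominator. -/
def ratDeriv (f : RatFunc ℂ) : RatFunc ℂ :=
  (algebraMap (Polynomial ℂ) (RatFunc ℂ)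
      (Polynomial.derivative f.num * f.denom - f.num * Polynomial.derivative f.denom)) /
    (algebraMap (Polynomial ℂ) (RatFunc ℂ) f.denom) ^ 2

/-- The quotient rule holds for every representation of a rational function as a fraction. -/
theorem ratDeriv_div (p q : Polynomial ℂ) (hq : q ≠ 0) :
    ratDeriv (algebraMap (Polynomial ℂ) (RatFunc ℂ) p / algebraMap (Polynomial ℂ) (RatFunc ℂ) q) =
      (algebraMap (Polynomial ℂ) (RatFunc ℂ)
        (Polynomial.derivative p * q - p * Polynomial.derivative q)) /
      (algebraMap (Polynomial ℂ) (RatFunc ℂ) q) ^ 2 := by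
  set f : RatFunc ℂ :=
    algebraMap (Polynomial ℂ) (RatFunc ℂ) p / algebraMap (Polynomial ℂ) (RatFunc ℂ) q with hf
  have hq' : algebraMap (Polynomial ℂ) (RatFunc ℂ) q ≠ 0 := RatFunc.algebraMap_ne_zero hq
  have hd : f.denom ≠ 0 := f.denom_ne_zero
  have hd' : algebraMap (Polynomial ℂ) (RatFunc ℂ) f.denom ≠ 0 := RatFunc.algebraMap_ne_zero hd
  have h1 : f.num * q = p * f.denom := by
    apply RatFunc.algebraMap_injective ℂ
    rw [map_mul, map_mul]
    have := f.num_div_denom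
    rw [div_eq_iff hd'] at this
    rw [this, hf]
    field_simp
  have h2 := congrArg Polynomial.derivative h1
  rw [Polynomial.derivative_mul, Polynomial.derivative_mul] at h2
  have h3 : (Polynomial.derivative f.num * f.denom - f.num * Polynomial.derivative f.denom) * q ^ 2
      = (Polynomial.derivative p * q - p * Polynomial.derivative q) * f.denom ^ 2 := by
    linear_combination (f.denom * q) * h2 -
      (Polynomial.derivative f.denom * q + Polynomial.derivative q * f.denom) * h1
  unfold ratDeriv
  rw [div_eq_div_iff (pow_ne_zero _ hd') (pow_ne_zero _ hq'), ← map_pow, ← map_pow, ← map_mul,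
    ← map_mul, h3]

theorem ratDeriv_add (f g : RatFunc ℂ) : ratDeriv (f + g) = ratDeriv f + ratDeriv g := by
  have hf := RatFunc.algebraMap_ne_zero f.denom_ne_zero
  have hg := RatFunc.algebraMap_ne_zero g.denom_ne_zero
  have h : f + g = algebraMap (Polynomial ℂ) (RatFunc ℂ) (f.num * g.denom + g.num * f.denom) /
      algebraMap (Polynomial ℂ) (RatFunc ℂ) (f.denom * g.denom) := by
    conv_lhs => rw [← f.num_div_denom, ← g.num_div_denom]
    simp only [map_mul, map_add]
    field_simp
  rw [h, ratDeriv_div _ _ (mul_ne_zero f.denom_ne_zero g.denom_ne_zero)]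
  unfold ratDeriv
  simp only [map_mul, map_add, map_sub, Polynomial.derivative_mul]
  field_simp
  ring

theorem ratDeriv_mul (f g : RatFunc ℂ) :
    ratDeriv (f * g) = f * ratDeriv g + g * ratDeriv f := by
  have hf := RatFunc.algebraMap_ne_zero f.denom_ne_zero
  have hg := RatFunc.algebraMap_ne_zero g.denom_ne_zero
  have h : f * g = algebraMap (Polynomial ℂ) (RatFunc ℂ) (f.num * g.num) /
      algebraMap (Polynomial ℂ) (RatFunc ℂ) (f.denom * g.denom) := by
    conv_lhs => rw [← f.num_div_denom, ← g.num_div_denom]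
    simp only [map_mul]
    field_simp
  rw [h, ratDeriv_div _ _ (mul_ne_zero f.denom_ne_zero g.denom_ne_zero)]
  conv_rhs =>
    rw [show f * ratDeriv g + g * ratDeriv f =
      (algebraMap (Polynomial ℂ) (RatFunc ℂ) f.num / algebraMap (Polynomial ℂ) (RatFunc ℂ) f.denom)
        * ratDeriv g +
      (algebraMap (Polynomial ℂ) (RatFunc ℂ) g.num / algebraMap (Polynomial ℂ) (RatFunc ℂ) g.denom)
        * ratDeriv f by rw [f.num_div_denom, g.num_div_denom]]
  unfold ratDeriv
  simp only [map_mul, map_add, map_sub, Polynomial.derivative_mul]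
  field_simp
  ring

/-- An additive map that satisfies the Leibniz rule, as a derivation. -/
def derivationOfLeibniz {S : Type*} [CommRing S] (f : S → S) (hadd : ∀ a b, f (a + b) = f a + f b)
    (hmul : ∀ a b, f (a * b) = a * f b + b * f a) : Derivation ℤ S S :=
  Derivation.mk' (AddMonoidHom.toIntLinearMap (AddMonoidHom.mk' f hadd)) hmul

/-- `ℂ(x)` with the derivation `d/dx`. -/
instance instDifferentialRatFunc : Differential (RatFunc ℂ) :=
  ⟨derivationOfLeibniz ratDeriv ratDeriv_add ratDeriv_mul⟩

theorem deriv_eq_ratDeriv (f : RatFunc ℂ) : f′ = ratDeriv f := rfl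

/-! ### Liouvillian functions and the types of liouvillian solutions -/

/-- `IsLiouvillian K` : the subfield `K` of the differential field `M ⊇ ℂ(x)` is reached from
`ℂ(x)` by finitely many steps `K ↦ K(α)`, where `α` is an exponential of an integral over `K`,
an integral over `K`, or algebraic over `K`. -/
inductive IsLiouvillian {M : Type*} [Field M] [Differential M] [Algebra (RatFunc ℂ) M] :
    IntermediateField (RatFunc ℂ) M → Prop
  | base : IsLiouvillian ⊥
  | exp_integral (K : IntermediateField (RatFunc ℂ) M) (α : M) (hK : IsLiouvillian K)
      (h0 : α ≠ 0) (hα : α′ / α ∈ K) :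
      IsLiouvillian (K ⊔ IntermediateField.adjoin (RatFunc ℂ) {α})
  | integral (K : IntermediateField (RatFunc ℂ) M) (α : M) (hK : IsLiouvillian K)
      (hα : α′ ∈ K) :
      IsLiouvillian (K ⊔ IntermediateField.adjoin (RatFunc ℂ) {α})
  | algebraic (K : IntermediateField (RatFunc ℂ) M) (α : M) (hK : IsLiouvillian K)
      (hα : IsAlgebraic K α) :
      IsLiouvillian (K ⊔ IntermediateField.adjoin (RatFunc ℂ) {α})

/-- `y` is a solution of `y'' = R y`. -/
def IsSolution (R : RatFunc ℂ) {L : Type*} [Field L] [Differential L] [Algebra (RatFunc ℂ) L]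
    (y : L) : Prop :=
  y′′ = algebraMap (RatFunc ℂ) L R * y

/-- `η` is a solution of `y'' = R y` of the form `η = exp (∫ ω dx)`. -/
def IsExpSolution (R : RatFunc ℂ) {L : Type*} [Field L] [Differential L]
    [Algebra (RatFunc ℂ) L] (ω η : L) : Prop :=
  η ≠ 0 ∧ η′ = ω * η ∧ IsSolution R η

/-- `y'' = R y` has a liouvillian solution of type 1: a solution `exp (∫ ω dx)`, in some
differential field extension of `ℂ(x)`, with `ω ∈ ℂ(x)`. -/
def HasTypeOneSolution (R : RatFunc ℂ) : Prop :=
  ∃ (L : Type) (_ : Field L) (_ : Differential L) (_ : Algebra (RatFunc ℂ) L)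
    (_ : DifferentialAlgebra (RatFunc ℂ) L) (ω : RatFunc ℂ) (η : L),
    IsExpSolution R (algebraMap (RatFunc ℂ) L ω) η

/-- `η` is a solution `exp (∫ ω dx)` of `y'' = R y` with `ω` algebraic of degree exactly 2 over
`ℂ(x)`. -/
def IsDegreeTwoExpSolution (R : RatFunc ℂ) {L : Type*} [Field L] [Differential L]
    [Algebra (RatFunc ℂ) L] (η : L) : Prop :=
  ∃ ω : L, IsAlgebraic (RatFunc ℂ) ω ∧ (minpoly (RatFunc ℂ) ω).natDegree = 2 ∧ IsExpSolution R ω η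

/-- `y'' = R y` has a liouvillian solution of type 2: a solution `exp (∫ ω dx)` with `ω` algebraic
of degree 2 over `ℂ(x)`, while there is no solution of type 1. -/
def HasTypeTwoSolution (R : RatFunc ℂ) : Prop :=
  (∃ (L : Type) (_ : Field L) (_ : Differential L) (_ : Algebra (RatFunc ℂ) L)
    (_ : DifferentialAlgebra (RatFunc ℂ) L) (η : L), IsDegreeTwoExpSolution R η) ∧
  ¬ HasTypeOneSolution R

/-- The element `y` of a differential field `L ⊇ ℂ(x)` is a liouvillian function that is a
combination, with constant coefficients, of two linearly independent solutions `exp (∫ ω dx)` of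
`y'' = R y` with `ω` of degree 2 over `ℂ(x)`; all of this inside one liouvillian field, in a
differential field extension `M` of `L`. -/
def IsLiouvillianOfDegreeTwo (R : RatFunc ℂ) {L : Type u} [Field L] [Differential L]
    [Algebra (RatFunc ℂ) L] (y : L) : Prop :=
  ∃ (M : Type u) (_ : Field M) (_ : Differential M) (_ : Algebra (RatFunc ℂ) M)
    (_ : DifferentialAlgebra (RatFunc ℂ) M) (_ : Algebra L M)
    (_ : DifferentialAlgebra L M) (_ : IsScalarTower (RatFunc ℂ) L M)
    (K : IntermediateField (RatFunc ℂ) M),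
    IsLiouvillian K ∧ algebraMap L M y ∈ K ∧
    ∃ η₁ ∈ K, ∃ η₂ ∈ K, ∃ c₁ ∈ K, ∃ c₂ ∈ K,
      IsDegreeTwoExpSolution R η₁ ∧ IsDegreeTwoExpSolution R η₂ ∧
      η₁ * η₂′ - η₁′ * η₂ ≠ 0 ∧ c₁′ = 0 ∧ c₂′ = 0 ∧
      algebraMap L M y = c₁ * η₁ + c₂ * η₂

/-- Every solution of `y'' = R y`, in every differential field extension of `ℂ(x)`, is liouvillian
of type 2. -/
def AllSolutionsLiouvillianOfTypeTwo (R : RatFunc ℂ) : Prop :=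
  HasTypeTwoSolution R ∧
  ∀ (L : Type u) [Field L] [Differential L] [Algebra (RatFunc ℂ) L]
    [DifferentialAlgebra (RatFunc ℂ) L] (y : L), IsSolution R y → IsLiouvillianOfDegreeTwo R y

/-! ### The Hess top -/

/-- The Hess conditions on the principal moments of inertia and the coordinates of the centre of
mass in the principal axes at the fixed point. -/
def HessConditions (A₁ A₂ A₃ x₁ x₂ x₃ : ℝ) : Prop :=
  x₃ = 0 ∧ A₂ * (A₃ - A₁) * x₂ ^ 2 = A₁ * (A₂ - A₃) * x₁ ^ 2 ∧ A₂ ≥ A₃ ∧ A₃ ≥ A₁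

/-- The coefficient `b` of `L₁ L₂` in the kinetic energy in the special coordinate system. -/
def coeffB (A₁ A₂ x₁ x₂ : ℝ) : ℝ :=
  (A₁ - A₂) * x₁ * x₂ / (A₁ * A₂ * (x₁ ^ 2 + x₂ ^ 2))

/-- The coefficient `c` of `(L₂² + L₃²) / 2` in the kinetic energy in the special coordinate
system. -/
def coeffC (A₃ : ℝ) : ℝ := 1 / A₃

/-- The dimensionless parameter `d₁ = b / c`. -/
def paramD (A₁ A₂ A₃ x₁ x₂ : ℝ) : ℝ := coeffB A₁ A₂ x₁ x₂ / coeffC A₃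

/-- `P₆ = x⁶ - 4 h x⁴ + 4 (h² - 1) x² + 4 k²`, in any commutative ring. -/
def sextic {S : Type*} [CommRing S] (h k x : S) : S :=
  x ^ 6 - 4 * h * x ^ 4 + 4 * (h ^ 2 - 1) * x ^ 2 + 4 * k ^ 2

/-- `P₆` as a polynomial over `ℂ`. -/
def sexticPoly (h k : ℂ) : Polynomial ℂ :=
  sextic (Polynomial.C h) (Polynomial.C k) Polynomial.X

/-- The coefficient `a(x)` of `u'' + a(x) u' + b(x) u = 0`. -/
def linA (d h k x : ℂ) : ℂ :=
  (d * x ^ 9 - 4 * k * x ^ 6 - 4 * d * (h ^ 2 - 1) * x ^ 5 + 12 * k * h * x ^ 4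
      - 8 * k ^ 2 * d * x ^ 3 - 8 * k * (h ^ 2 - 1) * x ^ 2 - 4 * k ^ 3) /
    (x * sextic h k x * (d * x ^ 3 - k))

/-- The coefficient `b(x)` of `u'' + a(x) u' + b(x) u = 0`. -/
def linB (d h k x : ℂ) : ℂ :=
  (d * x ^ 3 + k) * (d * x ^ 3 - k) / (x ^ 2 * sextic h k x)

/-- The coefficient `R = U / V` of the reduced equation `y'' = R y`, as an expression in any
field. -/
def potential {S : Type*} [Field S] (d h k x : S) : S :=
  (-(1 + 4 * d ^ 2) * d ^ 2 * x ^ 16 + 8 * (2 * d ^ 2 - 1) * d ^ 2 * h * x ^ 14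
    + 4 * (2 * d ^ 2 + 5) * d * k * x ^ 13 - 8 * (2 * d ^ 2 - 7) * (h ^ 2 - 1) * d ^ 2 * x ^ 12
    - 8 * (4 * d ^ 2 + 19) * d * k * h * x ^ 11
    + 8 * ((1 + 17 * d ^ 2 - 2 * d ^ 4) * k ^ 2 - 12 * (h ^ 2 - 1) * d ^ 2 * h) * x ^ 10
    + 576 * (h ^ 2 - 1) * k ^ 3 * d * x ^ 3
    + 16 * (2 * (h ^ 2 - 1) * d ^ 2 + 29 * h ^ 2 - 5) * d * k * x ^ 9
    + 8 * (6 * (h ^ 2 - 1) ^ 2 * d ^ 2 - (7 + 40 * d ^ 2) * k ^ 2 * h) * x ^ 8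
    - 240 * k ^ 4 * h * x ^ 2
    + 32 * ((d ^ 2 - 2) * k ^ 2 - 21 * (h ^ 2 - 1) * h) * d * k * x ^ 7
    + 16 * (14 * (h ^ 2 - 1) * d ^ 2 + 8 * h ^ 2 - 5) * k ^ 2 * x ^ 6
    + 288 * k ^ 5 * d * x
    + 96 * (4 * (h ^ 2 - 1) ^ 2 - 3 * k ^ 2 * h) * d * k * x ^ 5
    + 4 * ((32 * d ^ 2 + 35) * k ^ 2 - 24 * (h ^ 2 - 1) * h) * k ^ 2 * x ^ 4
    + 48 * (h ^ 2 - 1) * k ^ 4) /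
  (4 * (d * x ^ 3 - k) ^ 2 * sextic h k x ^ 2)

/-- `R` as a rational function. -/
def potentialRat (d h k : ℂ) : RatFunc ℂ :=
  potential (RatFunc.C d) (RatFunc.C h) (RatFunc.C k) RatFunc.X

/-- `u` is a holomorphic solution of `u'' + p u' + q u = 0` on the open set `U`. -/
def IsHolSolution (p q : ℂ → ℂ) (U : Set ℂ) (u : ℂ → ℂ) : Prop :=
  DifferentiableOn ℂ u U ∧ ∀ x ∈ U, deriv (deriv u) x + p x * deriv u x + q x * u x = 0

/-- On `U` : `s` is a branch of `√P₆`, `F` is a branch of `∫ k dx / (x √P₆)` and `G` is a branch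
of `½ ∫ a(x) dx`. -/
def IsBranch (d h k : ℂ) (U : Set ℂ) (s F G : ℂ → ℂ) : Prop :=
  ContinuousOn s U ∧ (∀ x ∈ U, s x ^ 2 = sextic h k x) ∧
  (∀ x ∈ U, HasDerivAt F (k / (x * s x)) x) ∧
  (∀ x ∈ U, HasDerivAt G (linA d h k x / 2) x)

end HessTop

end

noncomputable section

namespace HessTop

section Algebraic

open Polynomial

/-! ### The sextic -/

/-! For `d = 0` the coefficients collapse. With `f = k / (x √P₆)`, the coefficient `a` is the
logarithmic derivative of `x √P₆`, so `f' = -a f` and (E) reads `u'' + a u' - f² u = 0`. It is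
solved by `exp (± ∫ f)`, and (E') by the exponentials of the integrals of `a/2 ± f`. These
integrands have degree 2 over `ℂ(x)` because `P₆`, having simple roots, is not a square.

Type 1 is excluded through the Riccati equation. If `φ = u'/u` is rational, then `Q = x² P₆ φ² - k²`
satisfies `Q' = -2φQ`; it is a constant multiple of `u⁻²`. Hence `V = 1/Q` is a nonconstant rational
solution of `x² P₆ V'² = 4V(1 + k² V)` (`exists_first_order_of_riccati`). Pole orders away from `0`,
values at `0` and degrees at infinity show that every rational solution of that equation is constant
(`deriv_eq_zero_of_first_order`).

For an arbitrary solution, adjoin `√P₆` and one exponential `η`. The second solution is `x √P₆ / η`,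
the Wronskian is the constant `-2k`, and Cramer's rule gives constant coefficients
(`isLiouvillianOfDegreeTwo`). The analytic half integrates the first order equations satisfied by
`u' ± f u` (`isHolSolution_iff_of_deriv`). -/

theorem map_sextic {S T : Type*} [CommRing S] [CommRing T] (f : S →+* T) (h k x : S) :
    f (sextic h k x) = sextic (f h) (f k) (f x) := by
  simp only [sextic, map_add, map_sub, map_mul, map_pow, map_ofNat, map_one]

theorem natDegree_sexticPoly (h k : ℂ) : (sexticPoly h k).natDegree = 6 := by
  have : sexticPoly h k =
      X ^ 6 - C (4 * h) * X ^ 4 + C (4 * (h ^ 2 - 1)) * X ^ 2 + C (4 * k ^ 2) := by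
    simp only [sexticPoly, sextic, map_mul, map_sub, map_pow, map_one, map_ofNat]
  rw [this]
  compute_degree!

theorem sexticPoly_ne_zero (h k : ℂ) : sexticPoly h k ≠ 0 := by
  intro h0
  have := natDegree_sexticPoly h k
  simp [h0] at this

theorem eval_sexticPoly (h k x : ℂ) : (sexticPoly h k).eval x = sextic h k x := by
  simp [sexticPoly, sextic]

theorem not_sq_dvd_of_roots_nodup {P : ℂ[X]} (h0 : P ≠ 0) (hP : P.roots.Nodup) (c : ℂ) :
    ¬ (X - C c) ^ 2 ∣ P := by
  rw [← le_rootMultiplicity_iff h0, ← count_roots]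
  have := Multiset.nodup_iff_count_le_one.1 hP c
  omega

/-- As `ℂ[X]` is integrally closed, a rational square root is a polynomial; any root of it is a
double root of `P`. -/
theorem sq_ne_algebraMap {P : ℂ[X]} (hdeg : 0 < P.natDegree)
    (hP : ∀ c, ¬ (X - C c) ^ 2 ∣ P) (r : RatFunc ℂ) :
    r ^ 2 ≠ algebraMap ℂ[X] (RatFunc ℂ) P := by
  intro hr
  obtain ⟨p, rfl⟩ := IsIntegrallyClosed.exists_algebraMap_eq_of_isIntegral_pow (R := ℂ[X])
    (x := r) (n := 2) two_pos (hr ▸ isIntegral_algebraMap)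
  rw [← map_pow] at hr
  have hp := RatFunc.algebraMap_injective ℂ hr
  have hd : p.degree ≠ 0 := by
    intro h
    rw [← hp, natDegree_pow, natDegree_eq_zero_iff_degree_le_zero.2 h.le] at hdeg
    simp at hdeg
  obtain ⟨c, hc⟩ := IsAlgClosed.exists_root p hd
  exact hP c (hp ▸ pow_dvd_pow_of_dvd (dvd_iff_isRoot.2 hc) 2)

/-! ### A first order equation without nonconstant rational solutions -/

section FirstOrder

variable {P p q : ℂ[X]} {κ : ℂ}

/-- Here `V = p/q`. At a pole `c ≠ 0` of order `m + 1` the right side of `x² P V'² = 4V(1 + κV)` has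
a pole of order at most `2m + 2`, while `V'²` has one of order `2m + 4`. So `P` would have to vanish
doubly at `c`. -/
theorem eval_ne_zero_of_first_order (hsq : ∀ c, ¬ (X - C c) ^ 2 ∣ P) (hpq : IsCoprime p q)
    (hq : q ≠ 0)
    (heq : X ^ 2 * P * (derivative p * q - p * derivative q) ^ 2 =
      4 * p * (q + C κ * p) * q ^ 2) {c : ℂ} (hc : c ≠ 0) : q.eval c ≠ 0 := by
  intro hqc
  have hpc : p.eval c ≠ 0 := by
    intro hpc
    obtain ⟨u, v, huv⟩ := hpq
    have := congrArg (eval c) huv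
    simp [hqc, hpc] at this
  obtain ⟨r, hr, hrc⟩ := exists_eq_pow_rootMultiplicity_mul_and_not_dvd q hq c
  have hm : 0 < rootMultiplicity c q := (rootMultiplicity_pos hq).2 hqc
  obtain ⟨m, hm⟩ := Nat.exists_eq_succ_of_ne_zero hm.ne'
  rw [hm] at hr
  set ℓ : ℂ[X] := X - C c with hℓ
  have hℓ0 : ℓ ≠ 0 := X_sub_C_ne_zero c
  have hrc' : r.eval c ≠ 0 := fun h => hrc (dvd_iff_isRoot.2 h)
  -- The cofactor of `ℓ ^ m` in `p' q - p q'`. Its value at `c` is `-(m + 1) p(c) r(c)`, nonzero in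
  -- characteristic zero.
  set s : ℂ[X] := derivative p * ℓ * r - p * ((m + 1 : ℂ[X]) * r + ℓ * derivative r) with hs
  have hdℓ : derivative ℓ = 1 := by simp [hℓ]
  have hw : derivative p * q - p * derivative q = ℓ ^ m * s := by
    rw [hr, derivative_mul, Nat.succ_eq_add_one, derivative_pow_succ, hdℓ, hs]
    simp only [map_add, map_natCast, map_one]
    ring
  have hsc : s.eval c ≠ 0 := by
    have : s.eval c = -(p.eval c * ((m + 1 : ℂ) * r.eval c)) := by simp [hs, hℓ]
    rw [this]
    exact neg_ne_zero.2 (mul_ne_zero hpc (mul_ne_zero (Nat.cast_add_one_ne_zero m) hrc'))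
  have h1 : P * (X * s) ^ 2 = ℓ ^ 2 * (4 * p * (q + C κ * p) * r ^ 2) := by
    have h2 : ℓ ^ (2 * m) * (P * (X * s) ^ 2) =
        ℓ ^ (2 * m) * (ℓ ^ 2 * (4 * p * (q + C κ * p) * r ^ 2)) := by
      rw [hw] at heq
      calc _ = X ^ 2 * P * (ℓ ^ m * s) ^ 2 := by ring
        _ = 4 * p * (q + C κ * p) * q ^ 2 := heq
        _ = 4 * p * (q + C κ * p) * (ℓ ^ (m + 1) * r) ^ 2 := by rw [← hr]
        _ = _ := by ring
    exact mul_left_cancel₀ (pow_ne_zero _ hℓ0) h2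
  have hco : IsCoprime ℓ (X * s) := by
    refine (irreducible_X_sub_C c).coprime_iff_not_dvd.2 fun hd => ?_
    have := dvd_iff_isRoot.1 hd
    simp [IsRoot, hc, hsc] at this
  exact hsq c (hco.pow.dvd_of_dvd_mul_right ⟨_, h1⟩)

theorem eq_X_pow_of_eval_ne_zero (hq : q.Monic) (h : ∀ c ≠ 0, q.eval c ≠ 0) :
    ∃ n : ℕ, q = X ^ n := by
  obtain ⟨r, hr, hr0⟩ := exists_eq_pow_rootMultiplicity_mul_and_not_dvd q hq.ne_zero 0
  rw [C_0, sub_zero] at hr hr0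
  have hd : r.degree = 0 := by
    by_contra hd
    obtain ⟨c, hc⟩ := IsAlgClosed.exists_root r hd
    rcases eq_or_ne c 0 with rfl | hc0
    · exact hr0 (by simpa using dvd_iff_isRoot.2 hc)
    · refine h c hc0 ?_
      rw [hr, eval_mul, hc.eq_zero, mul_zero]
  have hrm : r.Monic := Monic.of_mul_monic_left (monic_X_pow _) (hr ▸ hq)
  refine ⟨rootMultiplicity 0 q, ?_⟩
  rw [hrm.natDegree_eq_zero.1 (natDegree_eq_of_degree_eq_some hd)] at hr
  simpa using hr

/-- The only possible pole is `0`, so `q = X ^ n` and `x V' = t / x ^ n` with `t = x p' - n p`. The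
equation becomes `P t² = 4p(x ^ n + κp)`, to be compared at `0` and at infinity. -/
theorem wronskian_eq_zero_of_first_order (hdeg : P.natDegree = 6)
    (hsq : ∀ c, ¬ (X - C c) ^ 2 ∣ P) (hκ : κ ≠ 0) (hP0 : P.eval 0 = 4 * κ)
    (hpq : IsCoprime p q) (hq : q.Monic)
    (heq : X ^ 2 * P * (derivative p * q - p * derivative q) ^ 2 =
      4 * p * (q + C κ * p) * q ^ 2) : derivative p * q - p * derivative q = 0 := by
  obtain ⟨n, rfl⟩ := eq_X_pow_of_eval_ne_zero hq
    fun c hc => eval_ne_zero_of_first_order hsq hpq hq.ne_zero heq hc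
  set w := derivative p * X ^ n - p * derivative (X ^ n) with hw
  set t : ℂ[X] := X * derivative p - C (n : ℂ) * p with ht
  have hX : (X : ℂ[X]) ≠ 0 := X_ne_zero
  have hXw : X * w = X ^ n * t := by
    have : (X : ℂ[X]) * derivative (X ^ n) = C (n : ℂ) * X ^ n := by
      rcases n with _ | n
      · simp
      · rw [derivative_X_pow]
        simp only [Nat.add_sub_cancel]
        ring
    rw [hw, mul_sub, mul_left_comm X p, this, ht]
    ring
  have h1 : P * t ^ 2 = 4 * p * (X ^ n + C κ * p) := by
    have h2 : X ^ (2 * n) * (P * t ^ 2) = X ^ (2 * n) * (4 * p * (X ^ n + C κ * p)) := by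
      calc _ = P * (X ^ n * t) ^ 2 := by ring
        _ = X ^ 2 * P * w ^ 2 := by rw [← hXw]; ring
        _ = _ := by rw [heq]; ring
    exact mul_left_cancel₀ (pow_ne_zero _ hX) h2
  -- If `n > 0`, then `t(0) = -n p(0)` with `p(0) ≠ 0`; since `P(0) = 4κ`, evaluation at `0` gives
  -- `n² = 1`.
  have hn : n ≤ 1 := by
    rcases Nat.eq_zero_or_pos n with rfl | hn
    · simp
    have hp0 : p.eval 0 ≠ 0 := by
      intro hpc
      obtain ⟨u, v, huv⟩ := hpq
      have := congrArg (eval 0) huv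
      simp [hpc, hn.ne'] at this
    have h2 := congrArg (eval 0) h1
    simp only [ht, eval_mul, eval_pow, eval_sub, eval_add, eval_X, eval_C, hP0, zero_mul, zero_sub,
      zero_pow hn.ne', zero_add, eval_ofNat] at h2
    have h3 : (n : ℂ) ^ 2 = 1 := by
      have h4 : 4 * κ * (p.eval 0) ^ 2 ≠ 0 :=
        mul_ne_zero (mul_ne_zero (by norm_num) hκ) (pow_ne_zero 2 hp0)
      apply mul_left_cancel₀ h4
      linear_combination h2
    have h4 : n ^ 2 = 1 := by exact_mod_cast h3
    nlinarith
  -- Degrees: `6 + 2 deg t ≤ deg p + max n (deg p)`. If `deg p = n ≤ 1`, the right side is at most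
  -- 2. Otherwise the top terms of `x p'` and `n p` do not cancel, so `deg t ≥ deg p`, and the right
  -- side is at most `2 deg p + 1`.
  have ht0 : t = 0 := by
    by_contra ht0
    have hd : (P * t ^ 2).natDegree = 6 + 2 * t.natDegree := by
      rw [natDegree_mul (by rintro rfl; simp at hdeg) (pow_ne_zero _ ht0), natDegree_pow, hdeg]
    have hle : (4 * p * (X ^ n + C κ * p)).natDegree ≤ p.natDegree + max n p.natDegree := by
      refine natDegree_mul_le.trans (add_le_add ?_ ?_)
      · exact natDegree_C_mul_le (4 : ℂ) p
      · exact (natDegree_add_le _ _).trans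
          (max_le_max (natDegree_X_pow_le n) (natDegree_C_mul_le _ _))
    rw [← h1, hd] at hle
    rcases eq_or_ne p.natDegree n with hl | hl
    · rw [hl, max_self] at hle
      omega
    · have hp : p ≠ 0 := by
        rintro rfl
        simp [ht] at ht0
      have hcoeff : t.coeff p.natDegree = ((p.natDegree : ℂ) - n) * p.leadingCoeff := by
        rw [ht, coeff_sub, coeff_C_mul, leadingCoeff, sub_mul]
        congr 1
        rcases p.natDegree with _ | l
        · simp
        · rw [coeff_X_mul, coeff_derivative, mul_comm]
          push_cast
          rfl
      have : p.natDegree ≤ t.natDegree := by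
        apply le_natDegree_of_ne_zero
        rw [hcoeff]
        exact mul_ne_zero (sub_ne_zero.2 (by exact_mod_cast hl)) (leadingCoeff_ne_zero.2 hp)
      have : max n p.natDegree ≤ p.natDegree + 1 := by omega
      omega
  rw [ht0, mul_zero] at hXw
  exact (mul_eq_zero.1 hXw).resolve_left hX

theorem deriv_eq_zero_of_first_order (hdeg : P.natDegree = 6)
    (hsq : ∀ c, ¬ (X - C c) ^ 2 ∣ P) (hκ : κ ≠ 0) (hP0 : P.eval 0 = 4 * κ) (V : RatFunc ℂ)
    (hV : RatFunc.X ^ 2 * algebraMap ℂ[X] (RatFunc ℂ) P * V′ ^ 2 =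
      4 * V * (1 + RatFunc.C κ * V)) : V′ = 0 := by
  have hd := RatFunc.algebraMap_ne_zero V.denom_ne_zero
  have hV' := deriv_eq_ratDeriv V
  unfold ratDeriv at hV'
  have hw := wronskian_eq_zero_of_first_order hdeg hsq hκ hP0 V.isCoprime_num_denom
    V.monic_denom (by
      apply RatFunc.algebraMap_injective ℂ
      rw [hV'] at hV
      conv at hV =>
        rhs
        rw [← V.num_div_denom]
      rw [← RatFunc.algebraMap_X, ← RatFunc.algebraMap_C] at hV
      field_simp at hV
      simp only [map_mul, map_pow, map_add, map_ofNat] at hV ⊢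
      linear_combination hV)
  rw [hV', hw]
  simp

end FirstOrder

/-! ### The linear equation of the Lagrange case -/

/-- The derivative of the sextic. -/
def sexticDeriv {S : Type*} [CommRing S] (h x : S) : S :=
  6 * x ^ 5 - 16 * h * x ^ 3 + 8 * (h ^ 2 - 1) * x

/-- The coefficient of `u'` for `d = 0`. -/
def lagrangeA {S : Type*} [Field S] (h k x : S) : S :=
  1 / x + sexticDeriv h x / (2 * sextic h k x)

/-- The derivative of `lagrangeA`. -/
def lagrangeADeriv {S : Type*} [Field S] (h k x : S) : S :=
  -1 / x ^ 2 + ((30 * x ^ 4 - 48 * h * x ^ 2 + 8 * (h ^ 2 - 1)) * sextic h k x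
    - sexticDeriv h x ^ 2) / (2 * sextic h k x ^ 2)

/-- At `d = 0` the factor `(d x³ - k)²` is just `k²` and cancels, leaving `a'/2 + a²/4 + f²`. -/
theorem potential_zero_eq {S : Type*} [Field S] [CharZero S] {h k x : S} (hk : k ≠ 0) (hx : x ≠ 0)
    (hP : sextic h k x ≠ 0) :
    potential 0 h k x = lagrangeADeriv h k x / 2 + lagrangeA h k x ^ 2 / 4 +
      k ^ 2 / (x ^ 2 * sextic h k x) := by
  unfold potential lagrangeADeriv lagrangeA
  have hP' := hP
  set Q := sextic h k x with hQ
  have hk2 : (0 * x ^ 3 - k) ^ 2 = k ^ 2 := by ring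
  rw [hk2]
  field_simp
  rw [hQ]
  unfold sextic sexticDeriv
  ring

theorem linA_zero_eq {h k x : ℂ} (hk : k ≠ 0) (hx : x ≠ 0) (hP : sextic h k x ≠ 0) :
    linA 0 h k x = lagrangeA h k x := by
  unfold linA lagrangeA
  have hk' : (0 * x ^ 3 - k) ≠ 0 := by simpa using hk
  rw [div_add_div _ _ hx (mul_ne_zero two_ne_zero hP),
    div_eq_div_iff (mul_ne_zero (mul_ne_zero hx hP) hk') (mul_ne_zero hx (mul_ne_zero two_ne_zero hP))]
  unfold sextic sexticDeriv
  ring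

theorem linB_zero_eq (h k x : ℂ) :
    linB 0 h k x = -(k ^ 2 / (x ^ 2 * sextic h k x)) := by
  unfold linB
  ring

/-! ### The reduced equation in a differential field -/

section DifferentialField

variable {M : Type*} [Field M] [Differential M] {h k x : M}

theorem deriv_sextic (hh : h′ = 0) (hk : k′ = 0) (hx : x′ = 1) :
    (sextic h k x)′ = sexticDeriv h x := by
  have h4 : (4 : M)′ = 0 := by simpa using Differential.deriv.map_natCast (A := M) 4
  unfold sextic sexticDeriv
  simp only [map_add, map_sub, Derivation.leibniz, Derivation.leibniz_pow, hh, hk, hx, h4,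
    Derivation.map_one_eq_zero, smul_eq_mul, nsmul_eq_mul]
  push_cast
  ring

theorem deriv_sexticDeriv (hh : h′ = 0) (hx : x′ = 1) :
    (sexticDeriv h x)′ = 30 * x ^ 4 - 48 * h * x ^ 2 + 8 * (h ^ 2 - 1) := by
  have hn (n : ℕ) : (n : M)′ = 0 := Differential.deriv.map_natCast n
  have h6 : (6 : M)′ = 0 := by simpa using hn 6
  have h8 : (8 : M)′ = 0 := by simpa using hn 8
  have h16 : (16 : M)′ = 0 := by simpa using hn 16
  unfold sexticDeriv
  simp only [map_add, map_sub, Derivation.leibniz, Derivation.leibniz_pow, hh, hx, h6, h8, h16,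
    Derivation.map_one_eq_zero, smul_eq_mul, nsmul_eq_mul]
  push_cast
  ring

variable [CharZero M]

theorem deriv_lagrangeA (hh : h′ = 0) (hk : k′ = 0) (hx : x′ = 1) (hx0 : x ≠ 0)
    (hP : sextic h k x ≠ 0) : (lagrangeA h k x)′ = lagrangeADeriv h k x := by
  have h2 : (2 : M)′ = 0 := by simpa using Differential.deriv.map_natCast (A := M) 2
  unfold lagrangeA lagrangeADeriv
  simp only [map_add, Derivation.leibniz_div, Derivation.leibniz, deriv_sextic hh hk hx,
    deriv_sexticDeriv hh hx, hx, h2, Derivation.map_one_eq_zero, smul_eq_mul]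
  field_simp
  ring

/-- A solution of the Riccati equation yields a nonconstant solution of a first order equation. -/
theorem exists_first_order_of_riccati (hh : h′ = 0) (hk : k′ = 0) (hx : x′ = 1) (hk0 : k ≠ 0)
    (hx0 : x ≠ 0) (hP0 : sextic h k x ≠ 0) (hsq : ∀ r : M, r ^ 2 ≠ sextic h k x) {ω : M}
    (hω : ω′ + ω ^ 2 = potential 0 h k x) :
    ∃ V : M, x ^ 2 * sextic h k x * V′ ^ 2 = 4 * V * (1 + k ^ 2 * V) ∧ V′ ≠ 0 := by
  have ha' := deriv_lagrangeA hh hk hx hx0 hP0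
  have haxP : x * sextic h k x * lagrangeA h k x * 2 =
      2 * sextic h k x + x * sexticDeriv h x := by
    unfold lagrangeA
    field_simp
  have hP := deriv_sextic hh hk hx
  have h2 : (2 : M)′ = 0 := by
    simpa using Differential.deriv.map_natCast (A := M) 2
  rw [potential_zero_eq hk0 hx0 hP0, ← ha'] at hω
  -- From here only `P' = sexticDeriv h x` and the relation `haxP`, which expresses `a` by `P` and
  -- `P'`, matter.
  generalize lagrangeA h k x = a at *
  generalize sextic h k x = P at *
  generalize sexticDeriv h x = P' at *
  obtain ⟨φ, hφ⟩ : ∃ φ, φ = ω - a / 2 := ⟨_, rfl⟩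
  have hφ' : φ′ = k ^ 2 / (x ^ 2 * P) - φ ^ 2 - a * φ := by
    have : φ′ = ω′ - a′ / 2 := by
      rw [hφ, map_sub, Derivation.leibniz_div_const _ _ _ h2, smul_eq_mul]
      ring
    rw [this, hφ]
    linear_combination hω
  have hφ0 : φ ≠ 0 := by
    intro h0
    rw [h0, map_zero] at hφ'
    have : k ^ 2 / (x ^ 2 * P) = 0 := by linear_combination -hφ'
    exact div_ne_zero (pow_ne_zero 2 hk0) (mul_ne_zero (pow_ne_zero 2 hx0) hP0) this
  -- For `φ = u'/u` this is `x² P (u'² - f² u²) / u²`, whose numerator is a first integral of (E).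
  -- If `Q = 0`, then `k / (x φ)` is a square root of `P`.
  obtain ⟨Q, hQ⟩ : ∃ Q, Q = x ^ 2 * P * φ ^ 2 - k ^ 2 := ⟨_, rfl⟩
  have hQ0 : Q ≠ 0 := by
    intro hQ0
    refine hsq (k / (x * φ)) ?_
    rw [div_pow, div_eq_iff (pow_ne_zero 2 (mul_ne_zero hx0 hφ0))]
    linear_combination -hQ.symm.trans hQ0
  have hQ' : Q′ = -2 * φ * Q := by
    rw [hQ]
    simp only [map_sub, Derivation.leibniz, Derivation.leibniz_pow, hk, hφ', hx, hP,
      smul_eq_mul, nsmul_eq_mul]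
    push_cast
    field_simp
    linear_combination (-φ ^ 2 * x) * haxP
  have hV' : (Q⁻¹)′ = 2 * φ * Q⁻¹ := by
    rw [Derivation.leibniz_inv, hQ', smul_eq_mul]
    field_simp
  refine ⟨Q⁻¹, ?_, ?_⟩
  · rw [hV']
    field_simp
    rw [hQ]
    ring
  · rw [hV']
    exact mul_ne_zero (mul_ne_zero two_ne_zero hφ0) (inv_ne_zero hQ0)

end DifferentialField

/-! ### No solution of type 1 over `ℂ(x)` -/

theorem deriv_ratFunc_C (c : ℂ) : (RatFunc.C c)′ = 0 := by
  have := ratDeriv_div (C c) 1 one_ne_zero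
  rw [deriv_eq_ratDeriv]
  simpa using this

theorem deriv_ratFunc_X : (RatFunc.X : RatFunc ℂ)′ = 1 := by
  have := ratDeriv_div X 1 one_ne_zero
  rw [deriv_eq_ratDeriv]
  simpa using this

theorem algebraMap_sexticPoly (h k : ℂ) :
    algebraMap ℂ[X] (RatFunc ℂ) (sexticPoly h k) =
      sextic (RatFunc.C h) (RatFunc.C k) RatFunc.X := by
  rw [sexticPoly, map_sextic, RatFunc.algebraMap_C, RatFunc.algebraMap_C, RatFunc.algebraMap_X]

theorem sextic_ratFunc_ne_zero (h k : ℂ) :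
    sextic (RatFunc.C h) (RatFunc.C k) (RatFunc.X : RatFunc ℂ) ≠ 0 := by
  rw [← algebraMap_sexticPoly]
  exact RatFunc.algebraMap_ne_zero (sexticPoly_ne_zero h k)

instance charZero_ratFunc : CharZero (RatFunc ℂ) :=
  charZero_of_injective_algebraMap (algebraMap ℂ (RatFunc ℂ)).injective

theorem sq_ne_sextic {h k : ℂ} (hroots : (sexticPoly h k).roots.Nodup) (r : RatFunc ℂ) :
    r ^ 2 ≠ sextic (RatFunc.C h) (RatFunc.C k) RatFunc.X := by
  rw [← algebraMap_sexticPoly]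
  exact sq_ne_algebraMap (by simp [natDegree_sexticPoly])
    (not_sq_dvd_of_roots_nodup (sexticPoly_ne_zero h k) hroots) r

/-- The Riccati equation of the reduced equation has no rational solution. -/
theorem riccati_ne {h k : ℂ} (hk : k ≠ 0) (hroots : (sexticPoly h k).roots.Nodup)
    (ω : RatFunc ℂ) : ω′ + ω ^ 2 ≠ potentialRat 0 h k := by
  intro hω
  rw [potentialRat, map_zero] at hω
  obtain ⟨V, hV, hV'⟩ := exists_first_order_of_riccati (deriv_ratFunc_C h) (deriv_ratFunc_C k)
    deriv_ratFunc_X (by simpa using hk) RatFunc.X_ne_zero (sextic_ratFunc_ne_zero h k)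
    (sq_ne_sextic hroots) hω
  refine hV' (deriv_eq_zero_of_first_order (P := sexticPoly h k) (κ := k ^ 2)
    (natDegree_sexticPoly h k) (not_sq_dvd_of_roots_nodup (sexticPoly_ne_zero h k) hroots)
    (pow_ne_zero 2 hk) (by rw [eval_sexticPoly]; simp [sextic]) V ?_)
  rw [algebraMap_sexticPoly, map_pow]
  exact hV

/-- From `η' = ω η` follows `η'' = (ω' + ω²) η`; cancelling `η` gives the Riccati equation in `L`,
and injectivity brings it down to `ℂ(x)`. -/
theorem not_hasTypeOneSolution {h k : ℂ} (hk : k ≠ 0) (hroots : (sexticPoly h k).roots.Nodup) :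
    ¬ HasTypeOneSolution (potentialRat 0 h k) := by
  rintro ⟨L, _, _, _, _, ω, η, hη, hη', hsol⟩
  refine riccati_ne hk hroots ω ((algebraMap (RatFunc ℂ) L).injective ?_)
  unfold IsSolution at hsol
  rw [hη', Derivation.leibniz, hη', deriv_algebraMap] at hsol
  simp only [smul_eq_mul] at hsol
  rw [map_add, map_pow]
  apply mul_right_cancel₀ hη
  linear_combination hsol

/-! ### Extensions of differential fields -/

section Fraction

variable {K : Type*} [Field K] (D : Derivation ℤ K[X] K[X])

/-- The extension of a derivation of `K[X]` to `K(X)` by the quotient rule. -/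
def fracDeriv (f : RatFunc K) : RatFunc K :=
  algebraMap K[X] (RatFunc K) (D f.num * f.denom - f.num * D f.denom) /
    (algebraMap K[X] (RatFunc K) f.denom) ^ 2

/-- The quotient rule is independent of the fraction: apply `D` to the cross-multiplied identity and
eliminate. Additivity and the Leibniz rule can then be checked on any representatives. -/
theorem fracDeriv_div (p q : K[X]) (hq : q ≠ 0) :
    fracDeriv D (algebraMap K[X] (RatFunc K) p / algebraMap K[X] (RatFunc K) q) =
      algebraMap K[X] (RatFunc K) (D p * q - p * D q) / (algebraMap K[X] (RatFunc K) q) ^ 2 := by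
  set f : RatFunc K := algebraMap K[X] (RatFunc K) p / algebraMap K[X] (RatFunc K) q with hf
  have hq' : algebraMap K[X] (RatFunc K) q ≠ 0 := RatFunc.algebraMap_ne_zero hq
  have hd' : algebraMap K[X] (RatFunc K) f.denom ≠ 0 :=
    RatFunc.algebraMap_ne_zero f.denom_ne_zero
  have h1 : f.num * q = p * f.denom := by
    apply RatFunc.algebraMap_injective K
    rw [map_mul, map_mul]
    have := f.num_div_denom
    rw [div_eq_iff hd'] at this
    rw [this, hf]
    field_simp
  have h2 := congrArg D h1
  rw [Derivation.leibniz, Derivation.leibniz] at h2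
  simp only [smul_eq_mul] at h2
  have h3 : (D f.num * f.denom - f.num * D f.denom) * q ^ 2
      = (D p * q - p * D q) * f.denom ^ 2 := by
    linear_combination (f.denom * q) * h2 - (D f.denom * q + D q * f.denom) * h1
  unfold fracDeriv
  rw [div_eq_div_iff (pow_ne_zero _ hd') (pow_ne_zero _ hq'), ← map_pow, ← map_pow, ← map_mul,
    ← map_mul, h3]

theorem fracDeriv_algebraMap (p : K[X]) :
    fracDeriv D (algebraMap K[X] (RatFunc K) p) = algebraMap K[X] (RatFunc K) (D p) := by
  simpa using fracDeriv_div D p 1 one_ne_zero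

theorem fracDeriv_add (f g : RatFunc K) :
    fracDeriv D (f + g) = fracDeriv D f + fracDeriv D g := by
  induction f using RatFunc.induction_on with | f p q hq => ?_
  induction g using RatFunc.induction_on with | f r t ht => ?_
  have hq' := RatFunc.algebraMap_ne_zero hq
  have ht' := RatFunc.algebraMap_ne_zero ht
  rw [div_add_div _ _ hq' ht', ← map_mul, ← map_mul, ← map_mul, ← map_add,
    fracDeriv_div _ _ _ (mul_ne_zero hq ht), fracDeriv_div _ _ _ hq, fracDeriv_div _ _ _ ht]
  simp only [map_mul, map_add, map_sub, Derivation.leibniz, smul_eq_mul]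
  field_simp
  ring

theorem fracDeriv_mul (f g : RatFunc K) :
    fracDeriv D (f * g) = f * fracDeriv D g + g * fracDeriv D f := by
  induction f using RatFunc.induction_on with | f p q hq => ?_
  induction g using RatFunc.induction_on with | f r t ht => ?_
  have hq' := RatFunc.algebraMap_ne_zero hq
  have ht' := RatFunc.algebraMap_ne_zero ht
  rw [div_mul_div_comm, ← map_mul, ← map_mul,
    fracDeriv_div _ _ _ (mul_ne_zero hq ht), fracDeriv_div _ _ _ hq, fracDeriv_div _ _ _ ht]
  simp only [map_mul, map_add, map_sub, Derivation.leibniz, smul_eq_mul]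
  field_simp
  ring

end Fraction

/-- A differential field can be extended by an exponential of an integral. -/
theorem exists_exp_extension (L : Type u) [Field L] [Differential L] (ω : L) :
    ∃ (M : Type u) (_ : Field M) (_ : Differential M) (_ : Algebra L M)
      (_ : DifferentialAlgebra L M) (η : M), η ≠ 0 ∧ η′ = algebraMap L M ω * η := by
  -- The derivation extending that of `L` with `X' = ω X`; the transcendental `X` serves as the
  -- exponential.
  let D : Derivation ℤ L[X] L[X] := Differential.implicitDeriv (C ω * X)
  let _ : Differential (RatFunc L) :=
    ⟨derivationOfLeibniz (fracDeriv D) (fracDeriv_add D) (fracDeriv_mul D)⟩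
  have hD (f : RatFunc L) : f′ = fracDeriv D f := rfl
  refine ⟨RatFunc L, inferInstance, inferInstance, inferInstance, ⟨fun a => ?_⟩, RatFunc.X,
    RatFunc.X_ne_zero, ?_⟩
  · rw [hD, IsScalarTower.algebraMap_apply L L[X] (RatFunc L), algebraMap_eq,
      fracDeriv_algebraMap, Differential.implicitDeriv_C,
      IsScalarTower.algebraMap_apply L L[X] (RatFunc L), algebraMap_eq]
  · rw [hD, ← RatFunc.algebraMap_X, fracDeriv_algebraMap, Differential.implicitDeriv_X, map_mul,
      IsScalarTower.algebraMap_apply L L[X] (RatFunc L), algebraMap_eq]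

/-- A differential field of characteristic zero can be extended by a square root. -/
theorem exists_sqrt_extension (L : Type u) [Field L] [Differential L] [CharZero L] (a : L) :
    ∃ (M : Type u) (_ : Field M) (_ : Differential M) (_ : Algebra L M)
      (_ : DifferentialAlgebra L M) (s : M), s ^ 2 = algebraMap L M a := by
  -- A splitting field covers the case where `a` is already a square in `L`. Being finite over a
  -- field of characteristic zero, it inherits a derivation.
  let p : L[X] := X ^ 2 - C a
  let _ : Differential p.SplittingField := Differential.differentialFiniteDimensional L _
  have hp : (p.map (algebraMap L p.SplittingField)).degree ≠ 0 := by
    rw [degree_map, degree_X_pow_sub_C two_pos]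
    decide
  obtain ⟨s, hs⟩ := Splits.exists_eval_eq_zero (SplittingField.splits p) hp
  refine ⟨p.SplittingField, inferInstance, inferInstance, inferInstance,
    Differential.differentialAlgebraFiniteDimensional, s, ?_⟩
  simp only [p, Polynomial.map_sub, Polynomial.map_pow, map_X, map_C, eval_sub, eval_pow, eval_X,
    eval_C] at hs
  exact sub_eq_zero.1 hs

theorem DifferentialAlgebra.comp {A B C : Type*} [CommRing A] [CommRing B] [CommRing C]
    [Algebra A B] [Algebra B C] [Algebra A C] [IsScalarTower A B C] [Differential A]
    [Differential B] [Differential C] [DifferentialAlgebra A B] [DifferentialAlgebra B C] :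
    DifferentialAlgebra A C where
  deriv_algebraMap a := by
    rw [IsScalarTower.algebraMap_apply A B C, deriv_algebraMap, deriv_algebraMap,
      ← IsScalarTower.algebraMap_apply]

/-! ### The solutions of the reduced equation -/

theorem deriv_wronskian_eq_zero {M : Type*} [Field M] [Differential M] {r y₁ y₂ : M} (h₁ : y₁′′ = r * y₁) (h₂ : y₂′′ = r * y₂) :
    (y₁ * y₂′ - y₁′ * y₂)′ = 0 := by
  simp only [map_sub, Derivation.leibniz, h₁, h₂, smul_eq_mul]
  ring

section Solutions

variable {M : Type*} [Field M] [Differential M] [CharZero M] {h k x s : M}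

theorem deriv_sqrt (hh : h′ = 0) (hk : k′ = 0) (hx : x′ = 1) (hs : s ^ 2 = sextic h k x)
    (hs0 : s ≠ 0) : s′ = sexticDeriv h x / (2 * s) := by
  have := congrArg (·′) hs
  simp only [Derivation.leibniz_pow, deriv_sextic hh hk hx, smul_eq_mul, nsmul_eq_mul] at this
  rw [eq_div_iff (mul_ne_zero two_ne_zero hs0)]
  push_cast at this
  linear_combination this

/-- With `f = k / (x s)` and `f' = -a f`, the cross term `a f` of `(a/2 + f)²` cancels `f'`, leaving
`a'/2 + a²/4 + f²`. -/
theorem riccati_sqrt (hh : h′ = 0) (hk : k′ = 0) (hx : x′ = 1) (hk0 : k ≠ 0) (hx0 : x ≠ 0)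
    (hs : s ^ 2 = sextic h k x) (hs0 : s ≠ 0) {ω : M}
    (hω : ω = lagrangeA h k x / 2 + k / (x * s)) : ω′ + ω ^ 2 = potential 0 h k x := by
  have hP0 : sextic h k x ≠ 0 := hs ▸ pow_ne_zero 2 hs0
  have h2 : (2 : M)′ = 0 := by
    simpa using Differential.deriv.map_natCast (A := M) 2
  rw [potential_zero_eq hk0 hx0 hP0, ← deriv_lagrangeA hh hk hx hx0 hP0, hω, map_add,
    Derivation.leibniz_div_const _ _ _ h2, Derivation.leibniz_div, Derivation.leibniz,
    deriv_sqrt hh hk hx hs hs0, hk, hx]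
  have ha : lagrangeA h k x = 1 / x + sexticDeriv h x / (2 * s ^ 2) := by rw [hs]; rfl
  rw [← hs]
  generalize (lagrangeA h k x)′ = a'
  rw [ha]
  simp only [smul_eq_mul]
  field_simp
  ring

theorem isSolution_of_riccati {L : Type*} [Field L] [Differential L] [Algebra (RatFunc ℂ) L]
    {R : RatFunc ℂ} {ω η : L} (hη : η′ = ω * η) (hω : ω′ + ω ^ 2 = algebraMap (RatFunc ℂ) L R) :
    IsSolution R η := by
  unfold IsSolution
  rw [hη, Derivation.leibniz, hη, ← hω]
  simp only [smul_eq_mul]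
  ring

end Solutions

/-- A quadratic kills `ω`, and `ω ∈ F` would make `b` a square in `F`. -/
theorem natDegree_minpoly_eq_two {F E : Type*} [Field F] [Field E] [Algebra F E] {ω : E} {a b : F}
    (hω : (ω - algebraMap F E a) ^ 2 = algebraMap F E b) (hb : ∀ r : F, r ^ 2 ≠ b) :
    IsAlgebraic F ω ∧ (minpoly F ω).natDegree = 2 := by
  set p : F[X] := (X - C a) ^ 2 - C b with hp
  have hdeg : ((X - C a) ^ 2).natDegree = 2 := by simp
  have hpd : p.natDegree = 2 := by rw [hp, natDegree_sub_C, hdeg]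
  have hp0 : p ≠ 0 := by
    intro h0
    simp [h0] at hpd
  have hpω : aeval ω p = 0 := by simp [hp, hω]
  have halg : IsAlgebraic F ω := ⟨p, hp0, hpω⟩
  refine ⟨halg, le_antisymm ?_ ?_⟩
  · rw [← hpd]
    exact natDegree_le_of_dvd (minpoly.dvd F ω hpω) hp0
  · rw [minpoly.two_le_natDegree_iff halg.isIntegral]
    rintro ⟨c, rfl⟩
    refine hb (c - a) ((algebraMap F E).injective ?_)
    rw [← hω, map_pow, map_sub]

section RatFuncAlgebra

variable {M : Type*} [Field M] [Algebra (RatFunc ℂ) M]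

theorem map_potentialRat (h k : ℂ) :
    algebraMap (RatFunc ℂ) M (potentialRat 0 h k) =
      potential 0 (algebraMap (RatFunc ℂ) M (RatFunc.C h)) (algebraMap (RatFunc ℂ) M (RatFunc.C k))
        (algebraMap (RatFunc ℂ) M RatFunc.X) := by
  simp only [potentialRat, potential, map_sextic, map_div₀, map_add, map_sub, map_mul, map_pow,
    map_neg, map_ofNat, map_one, map_zero]

theorem map_lagrangeA (h k : ℂ) :
    algebraMap (RatFunc ℂ) M (lagrangeA (RatFunc.C h) (RatFunc.C k) RatFunc.X) =
      lagrangeA (algebraMap (RatFunc ℂ) M (RatFunc.C h)) (algebraMap (RatFunc ℂ) M (RatFunc.C k))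
        (algebraMap (RatFunc ℂ) M RatFunc.X) := by
  simp only [lagrangeA, sexticDeriv, map_sextic, map_div₀, map_add, map_sub, map_mul, map_pow,
    map_ofNat, map_one]

theorem charZero_of_algebra_ratFunc : CharZero M :=
  charZero_of_injective_algebraMap (algebraMap (RatFunc ℂ) M).injective

variable [Differential M] [DifferentialAlgebra (RatFunc ℂ) M] {h k : ℂ} {s η : M}

theorem isDegreeTwoExpSolution (hk : k ≠ 0) (hroots : (sexticPoly h k).roots.Nodup)
    (hs : s ^ 2 = algebraMap (RatFunc ℂ) M
      (sextic (RatFunc.C h) (RatFunc.C k) RatFunc.X)) (hη0 : η ≠ 0)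
    (hη : η′ = (algebraMap (RatFunc ℂ) M (lagrangeA (RatFunc.C h) (RatFunc.C k) RatFunc.X) / 2 +
      algebraMap (RatFunc ℂ) M (RatFunc.C k) / (algebraMap (RatFunc ℂ) M RatFunc.X * s)) * η) :
    IsDegreeTwoExpSolution (potentialRat 0 h k) η := by
  have : CharZero M := charZero_of_algebra_ratFunc
  have hk0 : (RatFunc.C k : RatFunc ℂ) ≠ 0 := by simpa using hk
  have hX : (RatFunc.X : RatFunc ℂ) ≠ 0 := RatFunc.X_ne_zero
  have hP := sextic_ratFunc_ne_zero h k
  have hmP : algebraMap (RatFunc ℂ) M (sextic (RatFunc.C h) (RatFunc.C k) RatFunc.X) ≠ 0 := by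
    simpa using hP
  have hmX : algebraMap (RatFunc ℂ) M RatFunc.X ≠ 0 := by simpa using hX
  have hs0 : s ≠ 0 := by
    rintro rfl
    exact hmP (by rw [← hs]; simp)
  -- Here `(ω - a/2)² = k² / (x² P₆)`; a rational square root `r` of it would make `k / (x r)` one
  -- of `P₆`.
  obtain ⟨h1, h2⟩ := natDegree_minpoly_eq_two (F := RatFunc ℂ)
    (ω := algebraMap (RatFunc ℂ) M (lagrangeA (RatFunc.C h) (RatFunc.C k) RatFunc.X) / 2 +
      algebraMap (RatFunc ℂ) M (RatFunc.C k) / (algebraMap (RatFunc ℂ) M RatFunc.X * s))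
    (a := lagrangeA (RatFunc.C h) (RatFunc.C k) RatFunc.X / 2)
    (b := RatFunc.C k ^ 2 / (RatFunc.X ^ 2 * sextic (RatFunc.C h) (RatFunc.C k) RatFunc.X))
    (by
      simp only [map_div₀, map_mul, map_pow, map_ofNat, ← hs]
      ring)
    (by
      intro r hr
      have hr0 : r ≠ 0 := by
        rintro rfl
        refine div_ne_zero (pow_ne_zero 2 hk0) (mul_ne_zero (pow_ne_zero 2 hX) hP) ?_
        rw [← hr]
        simp
      refine sq_ne_sextic hroots (RatFunc.C k / (RatFunc.X * r)) ?_
      rw [div_pow, mul_pow, hr]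
      field_simp)
  refine ⟨_, h1, h2, hη0, hη, isSolution_of_riccati hη ?_⟩
  rw [map_potentialRat]
  refine riccati_sqrt ?_ ?_ ?_ ?_ hmX (by rw [hs, map_sextic]) hs0 (by rw [map_lagrangeA])
  · rw [deriv_algebraMap, deriv_ratFunc_C, map_zero]
  · rw [deriv_algebraMap, deriv_ratFunc_C, map_zero]
  · rw [deriv_algebraMap, deriv_ratFunc_X, map_one]
  · simpa using hk

end RatFuncAlgebra

/-- Every differential field over `ℂ(x)` extends to one that contains `√P₆` and a solution of the
reduced equation. -/
theorem exists_solution_extension (h k : ℂ) (L : Type u) [Field L] [Differential L]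
    [Algebra (RatFunc ℂ) L] [DifferentialAlgebra (RatFunc ℂ) L] :
    ∃ (M : Type u) (_ : Field M) (_ : Differential M) (_ : Algebra (RatFunc ℂ) M)
      (_ : DifferentialAlgebra (RatFunc ℂ) M) (_ : Algebra L M)
      (_ : DifferentialAlgebra L M) (_ : IsScalarTower (RatFunc ℂ) L M) (s η : M),
      s ^ 2 = algebraMap (RatFunc ℂ) M (sextic (RatFunc.C h) (RatFunc.C k) RatFunc.X) ∧ η ≠ 0 ∧
      η′ = (algebraMap (RatFunc ℂ) M (lagrangeA (RatFunc.C h) (RatFunc.C k) RatFunc.X) / 2 +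
        algebraMap (RatFunc ℂ) M (RatFunc.C k) / (algebraMap (RatFunc ℂ) M RatFunc.X * s)) * η := by
  have : CharZero L := charZero_of_algebra_ratFunc
  obtain ⟨N, _, _, _, _, s, hs⟩ := exists_sqrt_extension L
    (algebraMap (RatFunc ℂ) L (sextic (RatFunc.C h) (RatFunc.C k) RatFunc.X))
  let _ : Algebra (RatFunc ℂ) N := ((algebraMap L N).comp (algebraMap (RatFunc ℂ) L)).toAlgebra
  have : IsScalarTower (RatFunc ℂ) L N := IsScalarTower.of_algebraMap_eq fun _ => rfl
  have : DifferentialAlgebra (RatFunc ℂ) N := DifferentialAlgebra.comp (B := L)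
  obtain ⟨M, _, _, _, _, η, hη0, hη⟩ := exists_exp_extension N
    (algebraMap (RatFunc ℂ) N (lagrangeA (RatFunc.C h) (RatFunc.C k) RatFunc.X) / 2 +
        algebraMap (RatFunc ℂ) N (RatFunc.C k) / (algebraMap (RatFunc ℂ) N RatFunc.X * s))
  let _ : Algebra (RatFunc ℂ) M := ((algebraMap N M).comp (algebraMap (RatFunc ℂ) N)).toAlgebra
  let _ : Algebra L M := ((algebraMap N M).comp (algebraMap L N)).toAlgebra
  have : IsScalarTower (RatFunc ℂ) N M := IsScalarTower.of_algebraMap_eq fun _ => rfl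
  have : IsScalarTower L N M := IsScalarTower.of_algebraMap_eq fun _ => rfl
  have : IsScalarTower (RatFunc ℂ) L M := IsScalarTower.of_algebraMap_eq fun _ => rfl
  refine ⟨M, inferInstance, inferInstance, inferInstance, DifferentialAlgebra.comp (B := N),
    inferInstance, DifferentialAlgebra.comp (B := N), inferInstance, algebraMap N M s, η, ?_, hη0,
    ?_⟩
  · rw [← map_pow, hs]
    rfl
  · rw [hη, map_add, map_div₀, map_div₀, map_mul, map_ofNat]
    rfl

theorem isLiouvillianOfDegreeTwo {h k : ℂ} (hk : k ≠ 0) (hroots : (sexticPoly h k).roots.Nodup)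
    (L : Type u) [Field L] [Differential L] [Algebra (RatFunc ℂ) L]
    [DifferentialAlgebra (RatFunc ℂ) L] (y : L) (hy : IsSolution (potentialRat 0 h k) y) :
    IsLiouvillianOfDegreeTwo (potentialRat 0 h k) y := by
  obtain ⟨M, _, _, _, _, _, _, _, s, η, hs, hη0, hη⟩ := exists_solution_extension h k L
  have : CharZero M := charZero_of_algebra_ratFunc
  have hsol₁ := isDegreeTwoExpSolution hk hroots hs hη0 hη
  have hmP : algebraMap (RatFunc ℂ) M (sextic (RatFunc.C h) (RatFunc.C k) RatFunc.X) ≠ 0 := by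
    simpa using sextic_ratFunc_ne_zero h k
  have hs0 : s ≠ 0 := by
    rintro rfl
    exact hmP (by rw [← hs]; simp)
  set x : M := algebraMap (RatFunc ℂ) M RatFunc.X with hx
  set κ : M := algebraMap (RatFunc ℂ) M (RatFunc.C k) with hκ
  set a : M := algebraMap (RatFunc ℂ) M (lagrangeA (RatFunc.C h) (RatFunc.C k) RatFunc.X) with ha
  have hx0 : x ≠ 0 := by simpa [hx] using RatFunc.X_ne_zero
  have hκ0 : κ ≠ 0 := by simpa [hκ] using hk
  have hx' : x′ = 1 := by rw [hx, deriv_algebraMap, deriv_ratFunc_X, map_one]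
  have hC (c : ℂ) : (algebraMap (RatFunc ℂ) M (RatFunc.C c))′ = 0 := by
    rw [deriv_algebraMap, deriv_ratFunc_C, map_zero]
  have hs' := deriv_sqrt (hC h) (hC k) hx' (by rw [hs, map_sextic]) hs0
  have ha2 : a = 1 / x + sexticDeriv (algebraMap (RatFunc ℂ) M (RatFunc.C h)) x / (2 * s ^ 2) := by
    rw [ha, map_lagrangeA, hs, map_sextic]
    rfl
  -- The product of the two exponentials is `exp (∫ a)`, that is `x s` up to a constant. So the
  -- second solution, belonging to `-s`, lies in the field generated by `s` and `η`.
  have hζ0 : x * s / η ≠ 0 := div_ne_zero (mul_ne_zero hx0 hs0) hη0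
  have hζ : (x * s / η)′ = (a / 2 + κ / (x * -s)) * (x * s / η) := by
    rw [Derivation.leibniz_div, Derivation.leibniz, hη, hs', hx', ha2]
    simp only [smul_eq_mul]
    field_simp
    ring
  have hsol₂ : IsDegreeTwoExpSolution (potentialRat 0 h k) (x * s / η) :=
    isDegreeTwoExpSolution hk hroots (by rw [neg_sq, hs]) hζ0 hζ
  set ζ : M := x * s / η with hζdef
  have hηζ : η * ζ = x * s := by rw [hζdef]; field_simp
  have hW : η * ζ′ - η′ * ζ = -2 * κ := by
    rw [hη, hζ]
    have : η * ((a / 2 + κ / (x * -s)) * ζ) - (a / 2 + κ / (x * s)) * η * ζ =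
      (κ / (x * -s) - κ / (x * s)) * (η * ζ) := by ring
    rw [this, hηζ]
    field_simp
    ring
  have hW0 : η * ζ′ - η′ * ζ ≠ 0 := by
    rw [hW]
    exact mul_ne_zero (neg_ne_zero.2 two_ne_zero) hκ0
  have hWc : (-2 * κ)′ = 0 := by
    rw [← hW]
    obtain ⟨-, -, -, -, -, e₁⟩ := hsol₁
    obtain ⟨-, -, -, -, -, e₂⟩ := hsol₂
    exact deriv_wronskian_eq_zero e₁ e₂
  have hyM : (algebraMap L M y)′′ =
      algebraMap (RatFunc ℂ) M (potentialRat 0 h k) * algebraMap L M y := by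
    rw [deriv_algebraMap, deriv_algebraMap, hy, map_mul, ← IsScalarTower.algebraMap_apply]
  set Y := algebraMap L M y with hY
  -- Cramer's rule: both coefficients are quotients of Wronskians of solutions, hence constants.
  set c₁ : M := (Y * ζ′ - Y′ * ζ) / (-2 * κ) with hc₁
  set c₂ : M := (η * Y′ - η′ * Y) / (-2 * κ) with hc₂
  have hc₁' : c₁′ = 0 := by
    obtain ⟨-, -, -, -, -, e₂⟩ := hsol₂
    rw [hc₁, Derivation.leibniz_div_const _ _ _ hWc, deriv_wronskian_eq_zero hyM e₂, smul_zero]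
  have hc₂' : c₂′ = 0 := by
    obtain ⟨-, -, -, -, -, e₁⟩ := hsol₁
    rw [hc₂, Derivation.leibniz_div_const _ _ _ hWc, deriv_wronskian_eq_zero e₁ hyM, smul_zero]
  have hYc : Y = c₁ * η + c₂ * ζ := by
    rw [hc₁, hc₂, ← hW, div_mul_eq_mul_div, div_mul_eq_mul_div, ← add_div, eq_div_iff hW0]
    ring
  let K₀ : IntermediateField (RatFunc ℂ) M := ⊥
  let K₁ := K₀ ⊔ IntermediateField.adjoin (RatFunc ℂ) {s}
  let K₂ := K₁ ⊔ IntermediateField.adjoin (RatFunc ℂ) {η}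
  -- `L` may contain constants outside `ℂ`, so `c₁` and `c₂` are adjoined too, as integrals of `0`.
  let K₃ := K₂ ⊔ IntermediateField.adjoin (RatFunc ℂ) {c₁}
  let K₄ := K₃ ⊔ IntermediateField.adjoin (RatFunc ℂ) {c₂}
  have hmem (K : IntermediateField (RatFunc ℂ) M) (α : M) :
      α ∈ K ⊔ IntermediateField.adjoin (RatFunc ℂ) {α} :=
    (le_sup_right : _ ≤ K ⊔ _) (IntermediateField.mem_adjoin_simple_self _ _)
  have h₁₂ : K₁ ≤ K₂ := le_sup_left
  have h₂₃ : K₂ ≤ K₃ := le_sup_left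
  have h₃₄ : K₃ ≤ K₄ := le_sup_left
  have hs₁ : s ∈ K₁ := hmem _ _
  have hη₂ : η ∈ K₂ := hmem _ _
  have hζ₂ : ζ ∈ K₂ := div_mem (mul_mem (K₂.algebraMap_mem _) (h₁₂ hs₁)) hη₂
  have hc₁₄ : c₁ ∈ K₄ := h₃₄ (hmem _ _)
  have hc₂₄ : c₂ ∈ K₄ := hmem _ _
  have hη₄ : η ∈ K₄ := h₃₄ (h₂₃ hη₂)
  have hζ₄ : ζ ∈ K₄ := h₃₄ (h₂₃ hζ₂)
  have hK₁ : IsLiouvillian K₁ := by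
    refine .algebraic _ _ .base ?_
    have : IsAlgebraic (RatFunc ℂ) s := by
      refine .of_pow two_pos ?_
      rw [hs]
      exact isAlgebraic_algebraMap _
    exact this.tower_top _
  have hK₂ : IsLiouvillian K₂ := by
    refine .exp_integral _ _ hK₁ hη0 ?_
    rw [hη, mul_div_assoc, div_self hη0, mul_one]
    exact add_mem (div_mem (K₁.algebraMap_mem _) (ofNat_mem K₁ 2))
      (div_mem (K₁.algebraMap_mem _) (mul_mem (K₁.algebraMap_mem _) hs₁))
  have hK₃ : IsLiouvillian K₃ := .integral _ _ hK₂ (by rw [hc₁']; exact zero_mem _)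
  have hK₄ : IsLiouvillian K₄ := .integral _ _ hK₃ (by rw [hc₂']; exact zero_mem _)
  exact ⟨M, inferInstance, inferInstance, inferInstance, inferInstance, inferInstance,
    inferInstance, inferInstance, K₄, hK₄,
    by rw [← hY, hYc]; exact add_mem (mul_mem hc₁₄ hη₄) (mul_mem hc₂₄ hζ₄),
    η, hη₄, ζ, hζ₄, c₁, hc₁₄, c₂, hc₂₄, hsol₁, hsol₂, hW0, hc₁', hc₂', hYc⟩

theorem allSolutionsLiouvillianOfTypeTwo {h k : ℂ} (hk : k ≠ 0)
    (hroots : (sexticPoly h k).roots.Nodup) :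
    AllSolutionsLiouvillianOfTypeTwo.{u} (potentialRat 0 h k) := by
  refine ⟨⟨?_, not_hasTypeOneSolution hk hroots⟩, fun L _ _ _ _ y hy =>
    isLiouvillianOfDegreeTwo hk hroots L y hy⟩
  obtain ⟨M, _, _, _, _, -, -, -, s, η, hs, hη0, hη⟩ :=
    exists_solution_extension h k (RatFunc ℂ)
  exact ⟨M, _, _, _, ‹_›, η, isDegreeTwoExpSolution hk hroots hs hη0 hη⟩

end Algebraic

/-! ### Holomorphic solutions -/

section Holomorphic

variable {h k x : ℂ}

theorem hasDerivAt_sextic (h k x : ℂ) : HasDerivAt (sextic h k) (sexticDeriv h x) x := by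
  have := (((hasDerivAt_pow 6 x).sub ((hasDerivAt_pow 4 x).const_mul (4 * h))).add
    ((hasDerivAt_pow 2 x).const_mul (4 * (h ^ 2 - 1)))).add_const (4 * k ^ 2)
  refine this.congr_deriv ?_
  unfold sexticDeriv
  push_cast
  ring

theorem hasDerivAt_sexticDeriv (h x : ℂ) :
    HasDerivAt (sexticDeriv h) (30 * x ^ 4 - 48 * h * x ^ 2 + 8 * (h ^ 2 - 1)) x := by
  have := (((hasDerivAt_pow 5 x).const_mul 6).sub ((hasDerivAt_pow 3 x).const_mul (16 * h))).add
    ((hasDerivAt_id x).const_mul (8 * (h ^ 2 - 1)))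
  refine this.congr_deriv ?_
  push_cast
  ring

theorem hasDerivAt_lagrangeA (hx : x ≠ 0) (hP : sextic h k x ≠ 0) :
    HasDerivAt (lagrangeA h k) (lagrangeADeriv h k x) x := by
  have := ((hasDerivAt_const x (1 : ℂ)).div (hasDerivAt_id x) hx).add
    ((hasDerivAt_sexticDeriv h x).div ((hasDerivAt_sextic h k x).const_mul 2)
      (mul_ne_zero two_ne_zero hP))
  refine this.congr_deriv ?_
  unfold lagrangeADeriv
  simp only [id]
  field_simp
  ring

/-- Holomorphic solutions, in terms of a function `v` that is the derivative of `u`. -/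
theorem isHolSolution_iff {p q : ℂ → ℂ} {U : Set ℂ} (hU : IsOpen U) {u : ℂ → ℂ} :
    IsHolSolution p q U u ↔ ∃ v : ℂ → ℂ, (∀ x ∈ U, HasDerivAt u (v x) x) ∧
      ∀ x ∈ U, HasDerivAt v (-(p x * v x) - q x * u x) x := by
  constructor
  · rintro ⟨hd, he⟩
    refine ⟨deriv u, fun x hx => (hd.differentiableAt (hU.mem_nhds hx)).hasDerivAt,
      fun x hx => ?_⟩
    refine ((hd.deriv hU).differentiableAt (hU.mem_nhds hx)).hasDerivAt.congr_deriv ?_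
    linear_combination he x hx
  · rintro ⟨v, hu, hv⟩
    refine ⟨fun x hx => (hu x hx).differentiableAt.differentiableWithinAt, fun x hx => ?_⟩
    have hev : deriv u =ᶠ[nhds x] v :=
      Filter.eventuallyEq_of_mem (hU.mem_nhds hx) fun z hz => (hu z hz).deriv
    rw [hev.deriv_eq, (hv x hx).deriv, hev.eq_of_nhds]
    ring

theorem isHolSolution_congr {p q p' q' : ℂ → ℂ} {U : Set ℂ} (hp : ∀ x ∈ U, p x = p' x)
    (hq : ∀ x ∈ U, q x = q' x) {u : ℂ → ℂ} (h : IsHolSolution p q U u) :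
    IsHolSolution p' q' U u :=
  ⟨h.1, fun x hx => by rw [← hp x hx, ← hq x hx]; exact h.2 x hx⟩

theorem exists_eq_const_of_hasDerivAt_zero {U : Set ℂ} (hU : IsOpen U) (hU' : IsPreconnected U)
    {g : ℂ → ℂ} (hg : ∀ x ∈ U, HasDerivAt g 0 x) : ∃ c, ∀ x ∈ U, g x = c :=
  hU.exists_is_const_of_deriv_eq_zero hU'
    (fun x hx => (hg x hx).differentiableAt.differentiableWithinAt) fun x hx => (hg x hx).deriv

/-- The equation `u'' + a u' - f² u = 0` with `f' = -a f` has the solutions `exp (± ∫ f)`. -/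
theorem isHolSolution_iff_of_deriv {a f F : ℂ → ℂ} {U : Set ℂ} (hU : IsOpen U)
    (hU' : IsPreconnected U) (hF : ∀ x ∈ U, HasDerivAt F (f x) x)
    (hf : ∀ x ∈ U, HasDerivAt f (-(a x * f x)) x) (hf0 : ∀ x ∈ U, f x ≠ 0) (u : ℂ → ℂ) :
    IsHolSolution a (fun x => -f x ^ 2) U u ↔
      ∃ C₁ C₂ : ℂ, ∀ x ∈ U, u x = C₁ * Complex.exp (F x) + C₂ * Complex.exp (-F x) := by
  rw [isHolSolution_iff hU]
  constructor
  · rintro ⟨v, hu, hv⟩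
    -- As `f' = -a f`, the quotient `w = (u' + f u)/f` satisfies `w' = f w`, so `w exp (-F)` is
    -- constant. Changing the sign of `f` gives the second constant, and `u` is half the difference
    -- of the two quotients.
    obtain ⟨c₁, hc₁⟩ := exists_eq_const_of_hasDerivAt_zero hU hU'
      (g := fun x => (v x + f x * u x) / f x * Complex.exp (-F x)) fun x hx => by
        refine ((((hv x hx).add ((hf x hx).mul (hu x hx))).div (hf x hx) (hf0 x hx)).mul
          (hF x hx).neg.cexp).congr_deriv ?_
        have := hf0 x hx
        simp only [Pi.add_apply, Pi.mul_apply, Pi.div_apply, Pi.neg_apply]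
        field_simp
        ring
    obtain ⟨c₂, hc₂⟩ := exists_eq_const_of_hasDerivAt_zero hU hU'
      (g := fun x => (v x - f x * u x) / f x * Complex.exp (F x)) fun x hx => by
        refine ((((hv x hx).sub ((hf x hx).mul (hu x hx))).div (hf x hx) (hf0 x hx)).mul
          (hF x hx).cexp).congr_deriv ?_
        have := hf0 x hx
        simp only [Pi.sub_apply, Pi.mul_apply, Pi.div_apply]
        field_simp
        ring
    refine ⟨c₁ / 2, -(c₂ / 2), fun x hx => ?_⟩
    rw [← hc₁ x hx, ← hc₂ x hx, Complex.exp_neg]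
    have := hf0 x hx
    have := Complex.exp_ne_zero (F x)
    field_simp
    ring
  · rintro ⟨C₁, C₂, hu⟩
    refine ⟨fun x => f x * (C₁ * Complex.exp (F x) - C₂ * Complex.exp (-F x)), fun x hx => ?_,
      fun x hx => ?_⟩
    · have h1 := ((hF x hx).cexp.const_mul C₁).add ((hF x hx).neg.cexp.const_mul C₂)
      refine (h1.congr_of_eventuallyEq
        (Filter.eventuallyEq_of_mem (hU.mem_nhds hx) hu)).congr_deriv ?_
      simp only [Pi.neg_apply]
      ring
    · refine ((hf x hx).mul (((hF x hx).cexp.const_mul C₁).sub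
        ((hF x hx).neg.cexp.const_mul C₂))).congr_deriv ?_
      rw [hu x hx]
      simp only [Pi.sub_apply, Pi.neg_apply]
      ring

/-- The substitution `y = u exp (½ ∫ a)` removes the first order term. -/
theorem isHolSolution_reduced_iff {a a' b G : ℂ → ℂ} {U : Set ℂ} (hU : IsOpen U)
    (ha : ∀ x ∈ U, HasDerivAt a (a' x) x) (hG : ∀ x ∈ U, HasDerivAt G (a x / 2) x) (y : ℂ → ℂ) :
    IsHolSolution (fun _ => 0) (fun x => -(a' x / 2 + a x ^ 2 / 4 - b x)) U y ↔
      IsHolSolution a b U fun x => Complex.exp (-G x) * y x := by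
  rw [isHolSolution_iff hU, isHolSolution_iff hU]
  constructor
  · rintro ⟨v, hy, hv⟩
    refine ⟨fun x => Complex.exp (-G x) * (v x - a x / 2 * y x), fun x hx => ?_, fun x hx => ?_⟩
    · refine ((hG x hx).neg.cexp.mul (hy x hx)).congr_deriv ?_
      simp only [Pi.neg_apply]
      ring
    · refine ((hG x hx).neg.cexp.mul
        ((hv x hx).sub (((ha x hx).div_const 2).mul (hy x hx)))).congr_deriv ?_
      simp only [Pi.neg_apply, Pi.sub_apply, Pi.mul_apply]
      ring
  · rintro ⟨v, hu, hv⟩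
    -- Differentiability is known only for `exp (-G) y`; this identity transfers it to `y`.
    have hy : y = fun x => Complex.exp (G x) * (Complex.exp (-G x) * y x) := by
      funext x
      rw [← mul_assoc, ← Complex.exp_add, add_neg_cancel, Complex.exp_zero, one_mul]
    refine ⟨fun x => Complex.exp (G x) * (v x + a x / 2 * (Complex.exp (-G x) * y x)),
      fun x hx => ?_, fun x hx => ?_⟩
    · rw [hy]
      refine ((hG x hx).cexp.mul (hu x hx)).congr_deriv ?_
      rw [← hy]
      ring
    · refine ((hG x hx).cexp.mul
        ((hv x hx).add (((ha x hx).div_const 2).mul (hu x hx)))).congr_deriv ?_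
      have hyx := congrFun hy x
      simp only [Pi.add_apply, Pi.mul_apply]
      linear_combination (a' x / 2 + a x ^ 2 / 4 - b x) * (-hyx)

/-- The integrand of the branches is a solution of `f' = -a f`. -/
theorem hasDerivAt_integrand {U : Set ℂ} (hU : IsOpen U) {s F : ℂ → ℂ} (hk : k ≠ 0)
    (h0 : ∀ x ∈ U, x ≠ 0 ∧ sextic h k x ≠ 0) (hs : ∀ x ∈ U, s x ^ 2 = sextic h k x)
    (hF : ∀ x ∈ U, HasDerivAt F (k / (x * s x)) x) {x : ℂ} (hx : x ∈ U) :
    HasDerivAt (fun x => k / (x * s x)) (-(lagrangeA h k x * (k / (x * s x)))) x := by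
  have hs0 (z : ℂ) (hz : z ∈ U) : s z ≠ 0 := by
    intro h1
    refine (h0 z hz).2 ?_
    rw [← hs z hz, h1]
    ring
  -- No differentiability of `s` is needed: the integrand is the derivative of the holomorphic `F`.
  -- Its derivative then follows by differentiating its square `k² / (x² P₆)` and cancelling the
  -- factor `2f`.
  have hd : DifferentiableAt ℂ (fun x => k / (x * s x)) x :=
    (Complex.IsExactOn.differentiableOn hU ⟨F, hF⟩).differentiableAt (hU.mem_nhds hx)
  refine hd.hasDerivAt.congr_deriv ?_
  have h1 := hd.hasDerivAt.pow 2
  have hx0 := (h0 x hx).1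
  have hP := (h0 x hx).2
  have h2 := (hasDerivAt_const x (k ^ 2)).div ((hasDerivAt_pow 2 x).mul (hasDerivAt_sextic h k x))
    (mul_ne_zero (pow_ne_zero 2 hx0) hP)
  have hev : (fun x => k / (x * s x)) ^ 2 =ᶠ[nhds x]
      (fun _ => k ^ 2) / ((fun x => x ^ 2) * sextic h k) := by
    refine Filter.eventuallyEq_of_mem (hU.mem_nhds hx) fun z hz => ?_
    simp only [Pi.pow_apply, Pi.div_apply, Pi.mul_apply, div_pow, mul_pow, hs z hz]
  have h3 := h1.unique (h2.congr_of_eventuallyEq hev)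
  have hsx := hs0 x hx
  have hf0 : 2 * (k / (x * s x)) ≠ 0 :=
    mul_ne_zero two_ne_zero (div_ne_zero hk (mul_ne_zero hx0 hsx))
  apply mul_left_cancel₀ hf0
  simp only [Nat.cast_ofNat, Nat.add_one_sub_one, pow_one, Pi.mul_apply] at h3
  rw [h3]
  unfold lagrangeA
  rw [← hs x hx]
  field_simp
  ring

theorem isHolSolution_lagrange_iff {U : Set ℂ} (hU : IsOpen U) (hU' : IsPreconnected U)
    (hk : k ≠ 0) (h0 : ∀ x ∈ U, x ≠ 0 ∧ sextic h k x ≠ 0) {s F G : ℂ → ℂ}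
    (hb : IsBranch 0 h k U s F G) (u : ℂ → ℂ) :
    IsHolSolution (linA 0 h k) (linB 0 h k) U u ↔
      ∃ C₁ C₂ : ℂ, ∀ x ∈ U, u x = C₁ * Complex.exp (F x) + C₂ * Complex.exp (-F x) := by
  obtain ⟨-, hs, hF, -⟩ := hb
  rw [← isHolSolution_iff_of_deriv hU hU' hF
    (fun x hx => hasDerivAt_integrand hU hk h0 hs hF hx) fun x hx => ?_]
  · have hp (x) (hx : x ∈ U) : linA 0 h k x = lagrangeA h k x :=
      linA_zero_eq hk (h0 x hx).1 (h0 x hx).2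
    have hq (x) (hx : x ∈ U) : linB 0 h k x = -(k / (x * s x)) ^ 2 := by
      rw [linB_zero_eq, ← hs x hx, div_pow, mul_pow]
    exact ⟨isHolSolution_congr hp hq,
      isHolSolution_congr (fun x hx => (hp x hx).symm) fun x hx => (hq x hx).symm⟩
  · refine div_ne_zero hk (mul_ne_zero (h0 x hx).1 fun h1 => (h0 x hx).2 ?_)
    rw [← hs x hx, h1]
    ring

theorem isHolSolution_potential_iff {U : Set ℂ} (hU : IsOpen U) (hU' : IsPreconnected U)
    (hk : k ≠ 0) (h0 : ∀ x ∈ U, x ≠ 0 ∧ sextic h k x ≠ 0) {s F G : ℂ → ℂ}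
    (hb : IsBranch 0 h k U s F G) (y : ℂ → ℂ) :
    IsHolSolution (fun _ => 0) (fun x => -potential 0 h k x) U y ↔
      ∃ C₁ C₂ : ℂ, ∀ x ∈ U, y x =
        Complex.exp (G x) * (C₁ * Complex.exp (F x) + C₂ * Complex.exp (-F x)) := by
  have hp (x) (hx : x ∈ U) : linA 0 h k x = lagrangeA h k x :=
    linA_zero_eq hk (h0 x hx).1 (h0 x hx).2
  have ha (x) (hx : x ∈ U) : HasDerivAt (linA 0 h k) (lagrangeADeriv h k x) x :=
    (hasDerivAt_lagrangeA (h0 x hx).1 (h0 x hx).2).congr_of_eventuallyEq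
      (Filter.eventuallyEq_of_mem (hU.mem_nhds hx) hp)
  have hR (x) (hx : x ∈ U) : -potential 0 h k x =
      -(lagrangeADeriv h k x / 2 + linA 0 h k x ^ 2 / 4 - linB 0 h k x) := by
    rw [potential_zero_eq hk (h0 x hx).1 (h0 x hx).2, hp x hx, linB_zero_eq, sub_neg_eq_add]
  have h1 : IsHolSolution (fun _ => 0) (fun x => -potential 0 h k x) U y ↔
      IsHolSolution (linA 0 h k) (linB 0 h k) U fun x => Complex.exp (-G x) * y x := by
    rw [← isHolSolution_reduced_iff hU ha hb.2.2.2]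
    exact ⟨isHolSolution_congr (fun _ _ => rfl) hR,
      isHolSolution_congr (fun _ _ => rfl) fun x hx => (hR x hx).symm⟩
  rw [h1, isHolSolution_lagrange_iff hU hU' hk h0 hb]
  refine exists_congr fun C₁ => exists_congr fun C₂ => forall₂_congr fun x hx => ?_
  rw [Complex.exp_neg (G x), inv_mul_eq_iff_eq_mul₀ (Complex.exp_ne_zero _)]

/-- A holomorphic function without zeros on a disc has a continuous square root. -/
theorem exists_sqrt_on_ball {P : ℂ → ℂ} {x₀ : ℂ} {r : ℝ}
    (hP : DifferentiableOn ℂ P (Metric.ball x₀ r)) (h0 : ∀ x ∈ Metric.ball x₀ r, P x ≠ 0) :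
    ∃ s : ℂ → ℂ, DifferentiableOn ℂ s (Metric.ball x₀ r) ∧
      ∀ x ∈ Metric.ball x₀ r, s x ^ 2 = P x := by
  have hdP (x) (hx : x ∈ Metric.ball x₀ r) : HasDerivAt P (deriv P x) x :=
    (hP.differentiableAt (Metric.isOpen_ball.mem_nhds hx)).hasDerivAt
  -- A primitive `g` of `P' / (2P)` makes `P exp (-2g)` a constant `c`; a square root of `c` times
  -- `exp g` is the branch sought.
  obtain ⟨g, hg⟩ := ((hP.deriv Metric.isOpen_ball).div (hP.const_mul 2)
    fun x hx => mul_ne_zero two_ne_zero (h0 x hx)).isExactOn_ball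
  obtain ⟨c, hc⟩ := exists_eq_const_of_hasDerivAt_zero Metric.isOpen_ball
    (convex_ball x₀ r).isPreconnected
    (g := fun x => P x * Complex.exp (-(2 * g x))) fun x hx => by
      refine ((hdP x hx).mul ((hg x hx).const_mul 2).neg.cexp).congr_deriv ?_
      have := h0 x hx
      simp only [Pi.neg_apply, Pi.div_apply]
      field_simp
      ring
  obtain ⟨e, he⟩ := IsAlgClosed.exists_pow_nat_eq c two_pos
  refine ⟨fun x => e * Complex.exp (g x),
    fun x hx => ((hg x hx).cexp.const_mul e).differentiableAt.differentiableWithinAt,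
    fun x hx => ?_⟩
  rw [mul_pow, he, ← hc x hx, ← Complex.exp_nat_mul, mul_assoc, ← Complex.exp_add]
  simp

theorem exists_isBranch {x₀ : ℂ} {r : ℝ} (hk : k ≠ 0)
    (h0 : ∀ x ∈ Metric.ball x₀ r, x ≠ 0 ∧ sextic h k x ≠ 0) :
    ∃ s F G : ℂ → ℂ, IsBranch 0 h k (Metric.ball x₀ r) s F G := by
  obtain ⟨s, hs, hsq⟩ := exists_sqrt_on_ball (P := sextic h k) (x₀ := x₀) (r := r)
    (fun x _ => (hasDerivAt_sextic h k x).differentiableAt.differentiableWithinAt)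
    fun x hx => (h0 x hx).2
  obtain ⟨F, hF⟩ := ((differentiableOn_const k).div (differentiableOn_id.mul hs) fun x hx =>
    mul_ne_zero (h0 x hx).1 fun h1 => (h0 x hx).2 (by
      rw [← hsq x hx, h1]
      ring)).isExactOn_ball
  obtain ⟨G, hG⟩ := (DifferentiableOn.isExactOn_ball (f := fun x => lagrangeA h k x / 2)
    (c := x₀) (r := r) fun x hx => ((hasDerivAt_lagrangeA (h0 x hx).1
      (h0 x hx).2).div_const 2).differentiableAt.differentiableWithinAt)
  refine ⟨s, F, G, hs.continuousOn, hsq, hF, fun x hx => ?_⟩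
  rw [linA_zero_eq hk (h0 x hx).1 (h0 x hx).2]
  exact hG x hx

end Holomorphic

end HessTop

end

theorem theorem5 (A₁ A₂ A₃ x₁ x₂ x₃ : ℝ) (hA₁ : 0 < A₁) (hA₂ : 0 < A₂) (hA₃ : 0 < A₃)
    (hG : ¬ (x₁ = 0 ∧ x₂ = 0 ∧ x₃ = 0))
    (hHess : HessTop.HessConditions A₁ A₂ A₃ x₁ x₂ x₃)
    (d₁ : ℝ) (hd₁ : d₁ = HessTop.paramD A₁ A₂ A₃ x₁ x₂) (hLagrange : d₁ = 0)
    (h k₁ : ℝ) (hk₁ : k₁ ≠ 0) (hroots : (HessTop.sexticPoly h k₁).roots.Nodup) :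
    -- all solutions of `y'' = R y` are liouvillian of type 2; in particular none is of type 1
    HessTop.AllSolutionsLiouvillianOfTypeTwo.{u} (HessTop.potentialRat d₁ h k₁) ∧
    -- the general solutions of `u'' + a u' + b u = 0` and of `y'' = R y`, for all branches
    (∀ U : Set ℂ, IsOpen U → IsPreconnected U →
      (∀ x ∈ U, x ≠ 0 ∧ HessTop.sextic (h : ℂ) (k₁ : ℂ) x ≠ 0) →
      ∀ s F G : ℂ → ℂ, HessTop.IsBranch d₁ h k₁ U s F G →
        (∀ u : ℂ → ℂ,
          HessTop.IsHolSolution (HessTop.linA d₁ h k₁) (HessTop.linB d₁ h k₁) U u ↔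
            ∃ C₁ C₂ : ℂ, ∀ x ∈ U, u x = C₁ * Complex.exp (F x) + C₂ * Complex.exp (-F x)) ∧
        (∀ y : ℂ → ℂ,
          HessTop.IsHolSolution (fun _ => 0) (fun x => -HessTop.potential (d₁ : ℂ) h k₁ x) U y ↔
            ∃ C₁ C₂ : ℂ, ∀ x ∈ U, y x =
              Complex.exp (G x) * (C₁ * Complex.exp (F x) + C₂ * Complex.exp (-F x)))) ∧
    -- such branches exist on every disc that avoids `0` and the roots of `P₆`
    (∀ (x₀ : ℂ) (r : ℝ),
      (∀ x ∈ Metric.ball x₀ r, x ≠ 0 ∧ HessTop.sextic (h : ℂ) (k₁ : ℂ) x ≠ 0) →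
      ∃ s F G : ℂ → ℂ, HessTop.IsBranch d₁ h k₁ (Metric.ball x₀ r) s F G) := by
  subst hLagrange
  have hk : (k₁ : ℂ) ≠ 0 := by exact_mod_cast hk₁
  rw [Complex.ofReal_zero]
  exact ⟨HessTop.allSolutionsLiouvillianOfTypeTwo hk hroots,
    fun U hU hU' h0 s F G hb => ⟨HessTop.isHolSolution_lagrange_iff hU hU' hk h0 hb,
      HessTop.isHolSolution_potential_iff hU hU' hk h0 hb⟩,
    fun x₀ r h0 => HessTop.exists_isBranch hk h0⟩
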